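/- Let $L$ be a countable relational language and let $\mathcal K$ be a class of finite $L$-structures which is a Fraïssé class: it is hereditary (if $A$ embeds into $B\in\mathcal K$ then $A\in\mathcal K$), has joint embedding (any $A,B\in\mathcal K$ both embed into some $C\in\mathcal K$), has amalgamation (for all $A,B_0,B_1\in\mathcal K$ and embeddings $a_i:A\to B_i$, $i\in\{0,1\}$, there are $C\in\mathcal K$ and embeddings $b_i:B_i\to C$ with $b_0\circ a_0=b_1\circ a_1$), and contains structures of size at least $n$ for every $n\in\mathbb N$. For structures $A,C$ write $\binom{C}{A}$ for the set of substructures of $C$ isomorphic to $A$, and $C^A$ for the set of embeddings of $A$ into $C$. For $k,d\in\mathbb N$ write $[k]=\{0,\dots,k-1\}$ and - $C\to(B)^A_{k,d}$ if for every $\chi:\binom{C}{A}\to[k]$ there is $B'\in\binom{C}{B}$ with $|\chi(\binom{B'}{A})|\le d$; - $C\hookrightarrow(B)^A_{k,d}$ if for every $\chi:C^A\to[k]$ there is $b\in C^B$ with $|\chi(\{b\circ a: a\in B^A\})|\le d$. The Ramsey degree (respectively, the Ramsey degree for embeddings) of $A\in\mathcal K$ in $\mathcal K$ is the least $d\in\mathbb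 N$ such that for all $B\in\mathcal K$ and $k\ge 2$ there is $C\in\mathcal K$ with $C\to(B)^A_{k,d}$ (respectively, $C\hookrightarrow(B)^A_{k,d}$), and it is $\infty$ if no such $d$ exists. The Ramsey degree (respectively, the Ramsey degree for embeddings) of $\mathcal K$ is the supremum over $A\in\mathcal K$ of these degrees. The class $\mathcal K$ is Ramsey if its Ramsey degree is $1$. **Theorem.** If $\mathcal K$ is Ramsey, then the Ramsey degree for embeddings of $\mathcal K$ is either $\infty$ or equal to $2^m$ for some $m\in\mathbb N$. -/

import Mathlib

open FirstOrder

universe u v w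

namespace FraisseRamsey

open FirstOrder.Language CategoryTheory



variable {L : FirstOrder.Language.{u, v}}

/-- A Fraïssé class: a class of finite structures that is hereditary, has joint embedding and
amalgamation, and contains structures of size at least `n` for every natural number `n`.
(No bound on the number of isomorphism types is imposed.) -/
structure IsFraisseClass (K : Set (Bundled.{w} L.Structure)) : Prop where
  finite : ∀ A ∈ K, Finite A
  hereditary : Hereditary K
  jointEmbedding : JointEmbedding K
  amalgamation : Amalgamation K
  unbounded : ∀ n : ℕ, ∃ A ∈ K, n ≤ Nat.card A

/-- `C choose A`: the set of substructures of `C` which are isomorphic to `A`. -/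
def copies (A C : Bundled.{w} L.Structure) : Set (L.Substructure C) :=
  {S | Nonempty (S ≃[L] A)}

/-- The partition relation `C → (B)^A_{k,d}`: for every colouring `χ` of `C choose A` with `k`
colours there is `B'` in `C choose B` such that `χ` takes at most `d` values on the substructures
of `B'` which are isomorphic to `A`. -/
def Arrow (C B A : Bundled.{w} L.Structure) (k d : ℕ) : Prop :=
  ∀ χ : copies A C → Fin k, ∃ B' ∈ copies B C,
    (χ '' {A' : copies A C | (A' : L.Substructure C) ≤ B'}).encard ≤ d

/-- The partition relation for embeddings `C ↪ (B)^A_{k,d}`: for every colouring `χ` of the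
embeddings of `A` into `C` with `k` colours there is an embedding `b` of `B` into `C` such that `χ`
takes at most `d` values on `{b ∘ a | a : A ↪ B}`. -/
def EmbArrow (C B A : Bundled.{w} L.Structure) (k d : ℕ) : Prop :=
  ∀ χ : (A ↪[L] C) → Fin k, ∃ b : B ↪[L] C,
    (χ '' Set.range (fun a : A ↪[L] B => b.comp a)).encard ≤ d

/-- The Ramsey degree of `A` in `K`: the least natural number `d` such that for all `B ∈ K` and
`k ≥ 2` there is `C ∈ K` with `C → (B)^A_{k,d}`, and `⊤` if there is no such `d`. -/
noncomputable def ramseyDegreeOf (K : Set (Bundled.{w} L.Structure))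
    (A : Bundled.{w} L.Structure) : ℕ∞ :=
  sInf ((fun d : ℕ => (d : ℕ∞)) ''
    {d : ℕ | ∀ B ∈ K, ∀ k : ℕ, 2 ≤ k → ∃ C ∈ K, Arrow C B A k d})

/-- The Ramsey degree of `K`: the supremum of the Ramsey degrees of its members. -/
noncomputable def ramseyDegree (K : Set (Bundled.{w} L.Structure)) : ℕ∞ :=
  ⨆ A ∈ K, ramseyDegreeOf K A

/-- `K` is Ramsey if its Ramsey degree is `1`. -/
def IsRamsey (K : Set (Bundled.{w} L.Structure)) : Prop :=
  ramseyDegree K = 1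

/-- The Ramsey degree for embeddings of `A` in `K`: the least natural number `d` such that for all
`B ∈ K` and `k ≥ 2` there is `C ∈ K` with `C ↪ (B)^A_{k,d}`, and `⊤` if there is no such `d`. -/
noncomputable def embRamseyDegreeOf (K : Set (Bundled.{w} L.Structure))
    (A : Bundled.{w} L.Structure) : ℕ∞ :=
  sInf ((fun d : ℕ => (d : ℕ∞)) ''
    {d : ℕ | ∀ B ∈ K, ∀ k : ℕ, 2 ≤ k → ∃ C ∈ K, EmbArrow C B A k d})

/-- The Ramsey degree for embeddings of `K`: the supremum of the Ramsey degrees for embeddings of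
its members. -/
noncomputable def embRamseyDegree (K : Set (Bundled.{w} L.Structure)) : ℕ∞ :=
  ⨆ A ∈ K, embRamseyDegreeOf K A

end FraisseRamsey

/-!
In a Ramsey class the embeddings of `A` into a copy of `B` can be coloured uniformly up to
automorphisms of `A`, and no better, so the Ramsey degree for embeddings of `A` is `|Aut A|`. It
remains to see that `Aut B` is a `2`-group for `B ∈ K` as soon as the orders of the groups `Aut D`,
`D ∈ K`, are bounded.

Let `s ∈ Aut B` have odd order and let `x ∈ B`. There is a linear order on `B` such that whether `s`
preserves the order of the pair `{sᵏ x, sᵏ⁺¹ x}` does not depend on `k`. Indeed, amalgamation embeds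
a given `D` into some `E` such that for every embedding `j : B → D` there is an embedding
`f : D → E` with `f ∘ j = j ∘ s`, and `E` has a linear order for which `f` differs from the
inclusion by some `t ∈ Aut D`. So whether `s` preserves the order of a pair can be read off from the
set of all `t ∈ Aut D` which preserve the order of its image under `j`. This is a colouring of the
pairs in `D`, and the bound on `|Aut D|` fixes the number of its colours before `D` has to be
chosen, so some `D` and `j` make it constant on the pairs in question. But along a cyclic sequence
of odd length with distinct consecutive terms the steps `<` and `>` can neither always alternate nor
always agree, so `s x = x`.
-/

namespace FraisseRamsey

open FirstOrder.Language CategoryTheory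

theorem exists_injective_fin_of_card_le {α : Type*} [Finite α] {n : ℕ} (h : Nat.card α ≤ n) :
    ∃ f : α → Fin n, Function.Injective f :=
  ⟨_, (Fin.castLE_injective h).comp (Finite.equivFin α).injective⟩

theorem isPGroup_two_of_odd_pow_eq_one {G : Type*} [Group G] [Finite G]
    (h : ∀ (g : G) (q : ℕ), Odd q → g ^ q = 1 → g = 1) : IsPGroup 2 G := by
  intro g
  obtain ⟨k, m, hm, horder⟩ := Nat.exists_eq_two_pow_mul_odd (orderOf_pos g).ne'
  exact ⟨k, h _ m hm (by rw [← pow_mul, ← horder, pow_orderOf_eq_one])⟩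

section Automorphisms

variable {L : FirstOrder.Language.{u, v}} {M N : Type*} [L.Structure M] [L.Structure N]

/-- The automorphism group of a structure, with composition of maps as multiplication. -/
instance automorphismGroup : Group (M ≃[L] M) where
  mul f g := f.comp g
  one := FirstOrder.Language.Equiv.refl L M
  inv f := f.symm
  mul_assoc _ _ _ := rfl
  one_mul _ := rfl
  mul_one _ := rfl
  inv_mul_cancel f := FirstOrder.Language.Equiv.symm_comp_self f

theorem coe_automorphism_pow (s : M ≃[L] M) (k : ℕ) : ⇑(s ^ k) = s^[k] := by
  induction k with
  | zero => rfl
  | succ k ih => rw [pow_succ', Function.iterate_succ', ← ih]; rfl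

instance finite_automorphisms [Finite M] : Finite (M ≃[L] M) := DFunLike.finite _

instance finite_embeddings [Finite M] [Finite N] : Finite (M ↪[L] N) := DFunLike.finite _

theorem range_eq_range_iff_exists_comp_equiv {e f : M ↪[L] N} :
    e.toHom.range = f.toHom.range ↔ ∃ t : M ≃[L] M, f = e.comp t.toEmbedding := by
  constructor
  · intro h
    have lift : ∀ S : L.Substructure N, f.toHom.range = S →
        ∃ t : M ≃[L] S, ∀ x, (t x : N) = f x := by
      rintro S rfl
      exact ⟨f.equivRange, f.equivRange_apply⟩
    obtain ⟨t, ht⟩ := lift _ h.symm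
    refine ⟨e.equivRange.symm.comp t, Embedding.ext fun x => ?_⟩
    calc f x = e.equivRange (e.equivRange.symm (t x)) := by
          rw [FirstOrder.Language.Equiv.apply_symm_apply, ht]
      _ = e (e.equivRange.symm (t x)) := e.equivRange_apply _
  · rintro ⟨t, rfl⟩
    exact SetLike.coe_injective (t.surjective.range_comp e).symm

variable (L M N) in
/-- The embeddings of `M` into `N` form a free right `M ≃[L] M`-set, so a choice of
representatives of the orbits identifies each orbit with the group. -/
theorem exists_equivariant_colouring :
    ∃ c : (M ↪[L] N) → (M ≃[L] M), ∀ e t, c (e.comp t.toEmbedding) = c e * t := by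
  let range (e : M ↪[L] N) : L.Substructure N := e.toHom.range
  let rep (e : M ↪[L] N) : M ↪[L] N := Set.rangeSplitting range ⟨range e, e, rfl⟩
  have range_rep (e : M ↪[L] N) : range (rep e) = range e := Set.apply_rangeSplitting _ _
  choose c hc using fun e => range_eq_range_iff_exists_comp_equiv.1 (range_rep e)
  refine ⟨c, fun e t => ?_⟩
  have rep_comp : rep (e.comp t.toEmbedding) = rep e := by
    have : range (e.comp t.toEmbedding) = range e :=
      (range_eq_range_iff_exists_comp_equiv.2 ⟨t, rfl⟩).symm
    simp only [rep, this]
  have comp_eq : (rep e).comp (c (e.comp t.toEmbedding)).toEmbedding =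
      (rep e).comp (c e * t).toEmbedding :=
    calc _ = e.comp t.toEmbedding := by rw [← rep_comp, ← hc]
      _ = ((rep e).comp (c e).toEmbedding).comp t.toEmbedding := by rw [← hc]
  ext x
  exact DFunLike.congr_fun (Embedding.comp_injective _ comp_eq) x

end Automorphisms

section Degrees

variable {L : FirstOrder.Language.{u, v}} {K : Set (Bundled.{w} L.Structure)}
  {A B : Bundled.{w} L.Structure}

theorem exists_arrow_of_ramseyDegreeOf_le {d : ℕ} (h : ramseyDegreeOf K A ≤ d) (hB : B ∈ K)
    {k : ℕ} (hk : 2 ≤ k) : ∃ C ∈ K, Arrow C B A k d := by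
  have hlt : ramseyDegreeOf K A < (d + 1 : ℕ) := h.trans_lt (Nat.cast_lt.2 d.lt_succ_self)
  obtain ⟨_, ⟨d', hd', rfl⟩, hd'd⟩ := sInf_lt_iff.1 hlt
  have hle : (d' : ℕ∞) ≤ d := by exact_mod_cast Nat.lt_succ_iff.1 (Nat.cast_lt.1 hd'd)
  obtain ⟨C, hC, hCB⟩ := hd' B hB k hk
  refine ⟨C, hC, fun χ => ?_⟩
  obtain ⟨B', hB', hχ⟩ := hCB χ
  exact ⟨B', hB', hχ.trans hle⟩

namespace IsRamsey

theorem nonempty (hR : IsRamsey K) : K.Nonempty := by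
  rw [Set.nonempty_iff_ne_empty]
  rintro rfl
  simp [IsRamsey, ramseyDegree] at hR

theorem ramseyDegreeOf_le_one (hR : IsRamsey K) (hA : A ∈ K) : ramseyDegreeOf K A ≤ 1 :=
  (le_iSup₂ (f := fun A (_ : A ∈ K) => ramseyDegreeOf K A) A hA).trans_eq hR

theorem exists_monochromatic (hR : IsRamsey K) (hA : A ∈ K) (hB : B ∈ K) (κ : Type*) [Finite κ] :
    ∃ C ∈ K, ∀ χ : L.Substructure C → κ, ∃ b : B ↪[L] C, ∀ e f : A ↪[L] B,
      χ (b.comp e).toHom.range = χ (b.comp f).toHom.range := by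
  obtain ⟨n, ⟨i⟩⟩ := Finite.exists_equiv_fin κ
  obtain ⟨C, hC, h⟩ := exists_arrow_of_ramseyDegreeOf_le (d := 1)
    (by exact_mod_cast hR.ramseyDegreeOf_le_one hA) hB (k := n + 2) (by omega)
  refine ⟨C, hC, fun χ => ?_⟩
  obtain ⟨B', ⟨φ⟩, hB'⟩ := h fun S => Fin.castAdd 2 (i (χ S))
  let b : B ↪[L] C := B'.subtype.comp φ.symm.toEmbedding
  have range_le (e : A ↪[L] B) : (b.comp e).toHom.range ≤ B' := by
    rintro _ ⟨x, rfl⟩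
    exact (φ.symm (e x)).2
  have range_mem (e : A ↪[L] B) : (b.comp e).toHom.range ∈ copies A C :=
    ⟨(Embedding.equivRange _).symm⟩
  refine ⟨b, fun e f => i.injective (Fin.castAdd_injective _ 2 ?_)⟩
  exact Set.encard_le_one_iff.1 hB' _ _ ⟨⟨_, range_mem e⟩, range_le e, rfl⟩
    ⟨⟨_, range_mem f⟩, range_le f, rfl⟩

theorem exists_colour_eq_colour_comp_equiv (hR : IsRamsey K) (hA : A ∈ K) (hB : B ∈ K)
    (κ : Type*) [Finite κ] :
    ∃ C ∈ K, ∀ χ : (A ↪[L] C) → κ, ∃ b : B ↪[L] C, ∀ e f : A ↪[L] B, ∃ t : A ≃[L] A,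
      χ (b.comp e) = χ ((b.comp f).comp t.toEmbedding) := by
  obtain ⟨C, hC, h⟩ := hR.exists_monochromatic hA hB (Set κ)
  refine ⟨C, hC, fun χ => ?_⟩
  obtain ⟨b, hb⟩ := h fun S => χ '' {e | S = e.toHom.range}
  refine ⟨b, fun e f => ?_⟩
  have hmem : χ (b.comp e) ∈ χ '' {g | (b.comp f).toHom.range = g.toHom.range} := by
    rw [← hb e f]
    exact ⟨_, rfl, rfl⟩
  obtain ⟨g, hg, hχ⟩ := hmem
  obtain ⟨t, rfl⟩ := range_eq_range_iff_exists_comp_equiv.1 hg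
  exact ⟨t, hχ.symm⟩

theorem exists_embArrow_card_automorphisms [Finite A] (hR : IsRamsey K) (hA : A ∈ K) (hB : B ∈ K)
    (k : ℕ) : ∃ C ∈ K, EmbArrow C B A k (Nat.card (A ≃[L] A)) := by
  obtain ⟨C, hC, h⟩ := hR.exists_colour_eq_colour_comp_equiv hA hB (Fin k)
  refine ⟨C, hC, fun χ => ?_⟩
  obtain ⟨b, hb⟩ := h χ
  refine ⟨b, ?_⟩
  rcases isEmpty_or_nonempty (A ↪[L] B) with _ | ⟨⟨f⟩⟩
  · simp [Set.range_eq_empty]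
  calc (χ '' Set.range fun a : A ↪[L] B => b.comp a).encard
      ≤ (Set.range fun t : A ≃[L] A => χ ((b.comp f).comp t.toEmbedding)).encard := by
        refine Set.encard_le_encard ?_
        rintro _ ⟨_, ⟨e, rfl⟩, rfl⟩
        obtain ⟨t, ht⟩ := hb e f
        exact ⟨t, ht.symm⟩
    _ ≤ (Set.univ : Set (A ≃[L] A)).encard := by
        rw [← Set.image_univ]
        exact Set.encard_image_le _ _
    _ = Nat.card (A ≃[L] A) := by rw [Set.encard_univ, ENat.card_eq_coe_natCard]

end IsRamsey

theorem card_automorphisms_le_of_embArrow {C : Bundled.{w} L.Structure} [Finite A] {k d : ℕ}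
    (hk : Nat.card (A ≃[L] A) ≤ k) (h : EmbArrow C A A k d) : Nat.card (A ≃[L] A) ≤ d := by
  obtain ⟨c, hc⟩ := exists_equivariant_colouring L A C
  obtain ⟨i, i_injective⟩ := exists_injective_fin_of_card_le hk
  obtain ⟨b, hb⟩ := h fun e => i (c e)
  have colours_injective : Function.Injective fun t : A ≃[L] A => i (c b * t) :=
    i_injective.comp (mul_right_injective (c b))
  have hle : (Nat.card (A ≃[L] A) : ℕ∞) ≤ d :=
    calc (Nat.card (A ≃[L] A) : ℕ∞)
        = (Set.range fun t : A ≃[L] A => i (c b * t)).encard := by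
          rw [← Set.image_univ, colours_injective.encard_image, Set.encard_univ,
            ENat.card_eq_coe_natCard]
      _ ≤ ((fun e => i (c e)) '' Set.range fun a : A ↪[L] A => b.comp a).encard := by
          refine Set.encard_le_encard ?_
          rintro _ ⟨t, rfl⟩
          exact ⟨_, ⟨t.toEmbedding, rfl⟩, congrArg i (hc b t)⟩
      _ ≤ d := hb
  exact_mod_cast hle

theorem IsRamsey.embRamseyDegreeOf_eq_card_automorphisms [Finite A] (hR : IsRamsey K)
    (hA : A ∈ K) : embRamseyDegreeOf K A = Nat.card (A ≃[L] A) := by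
  apply le_antisymm
  · exact sInf_le ⟨_, fun B hB k _ => hR.exists_embArrow_card_automorphisms hA hB k, rfl⟩
  · apply le_sInf
    rintro _ ⟨d, hd, rfl⟩
    obtain ⟨C, -, h⟩ := hd A hA (Nat.card (A ≃[L] A) + 2) (by omega)
    exact Nat.cast_le.2 (card_automorphisms_le_of_embArrow (by omega) h)

theorem embRamseyDegreeOf_le_embRamseyDegree (hA : A ∈ K) :
    embRamseyDegreeOf K A ≤ embRamseyDegree K :=
  le_iSup₂ (f := fun A (_ : A ∈ K) => embRamseyDegreeOf K A) A hA

theorem exists_embRamseyDegreeOf_eq_embRamseyDegree (hK : K.Nonempty)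
    (htop : embRamseyDegree K ≠ ⊤) : ∃ A ∈ K, embRamseyDegreeOf K A = embRamseyDegree K := by
  have := hK.to_subtype
  have hsup : embRamseyDegree K = ⨆ A : K, embRamseyDegreeOf K A := iSup_subtype'
  obtain ⟨A, hA⟩ := ENat.exists_eq_iSup_of_lt_top (hsup ▸ htop.lt_top)
  exact ⟨A, A.2, hA.trans hsup.symm⟩

end Degrees

section PeriodicSequences

variable {α : Type*} {a : ℕ → α} {q : ℕ}

theorem exists_turn_of_periodic [LinearOrder α] (hq : 0 < q) (ha : Function.Periodic a q)
    (hne : ∀ k, a k ≠ a (k + 1)) :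
    ∃ k, ¬(a k < a (k + 1) ↔ a (k + 1) < a (k + 2)) := by
  by_contra! h
  have step_iff (k : ℕ) : a 0 < a 1 ↔ a k < a (k + 1) := by
    induction k with
    | zero => rfl
    | succ k ih => exact ih.trans (h k)
  have haq : a q = a 0 := ha.eq
  by_cases h0 : a 0 < a 1
  · have : StrictMono a := strictMono_nat_of_lt_succ fun k => (step_iff k).1 h0
    exact (this hq).ne' haq
  · have : StrictAnti a := strictAnti_nat_of_succ_lt fun k =>
      (not_lt.1 (mt (step_iff k).2 h0)).lt_of_ne (hne k).symm
    exact (this hq).ne haq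

theorem exists_not_turn_of_odd_periodic [LT α] (hq : Odd q) (ha : Function.Periodic a q) :
    ∃ k, (a k < a (k + 1) ↔ a (k + 1) < a (k + 2)) := by
  by_contra! h
  have step_iff (k : ℕ) : a k < a (k + 1) ↔ (a 0 < a 1 ↔ Even k) := by
    induction k with
    | zero => simp
    | succ k ih =>
      have := h k
      rw [Nat.even_add_one]
      tauto
  have hstep := step_iff q
  rw [add_comm, ha 1, ha.eq] at hstep
  have := Nat.not_even_iff_odd.2 hq
  tauto

theorem monovaryOn_pair_iff {ι β : Type*} [LinearOrder α] [LinearOrder β] {f : ι → α} {g : ι → β}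
    {x y : ι} (hf : f x ≠ f y) (hg : g x ≠ g y) :
    MonovaryOn f g {x, y} ↔ (f x < f y ↔ g x < g y) := by
  simp only [MonovaryOn, Set.mem_insert_iff, Set.mem_singleton_iff, forall_eq_or_imp, forall_eq,
    lt_irrefl, le_refl, imp_true_iff, true_and, and_true]
  grind

theorem isFixedPt_of_odd_of_monovaryOn_iff [LinearOrder α] {M : Type*} {w : M → α}
    (hw : Function.Injective w) {s : M → M} (hs : Function.Injective s) {x : M} (hq : Odd q)
    (hx : Function.IsPeriodicPt s q x)
    (h : ∀ k, MonovaryOn (w ∘ s) w {s^[k] x, s^[k + 1] x} ↔ MonovaryOn (w ∘ s) w {x, s x}) :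
    Function.IsFixedPt s x := by
  by_contra hfix
  let a (k : ℕ) : α := w (s^[k] x)
  have orbit_ne (k : ℕ) : s^[k] x ≠ s^[k + 1] x := fun hk =>
    hfix (hs.iterate k (hk.trans (Function.iterate_succ_apply s k x))).symm
  have a_ne (k : ℕ) : a k ≠ a (k + 1) := hw.ne (orbit_ne k)
  have a_periodic : Function.Periodic a q := fun k => by
    simp only [a, Function.iterate_add_apply, hx.eq]
  have turn_iff (k : ℕ) : (a k < a (k + 1) ↔ a (k + 1) < a (k + 2)) ↔
      MonovaryOn (w ∘ s) w {s^[k] x, s^[k + 1] x} := by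
    have comp_eq (l : ℕ) : (w ∘ s) (s^[l] x) = a (l + 1) :=
      congrArg w (Function.iterate_succ_apply' s l x).symm
    have ws_ne : (w ∘ s) (s^[k] x) ≠ (w ∘ s) (s^[k + 1] x) := hw.ne (hs.ne (orbit_ne k))
    rw [monovaryOn_pair_iff ws_ne (hw.ne (orbit_ne k)), comp_eq, comp_eq]
    exact iff_comm
  obtain ⟨k, hk⟩ := exists_turn_of_periodic hq.pos a_periodic a_ne
  obtain ⟨l, hl⟩ := exists_not_turn_of_odd_periodic hq a_periodic
  rw [turn_iff, h] at hk hl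
  exact hk hl

end PeriodicSequences

section OddOrder

variable {L : FirstOrder.Language.{u, v}} {K : Set (Bundled.{w} L.Structure)}
  {A B D E : Bundled.{w} L.Structure}

theorem exists_extension_of_amalgamation (hK : Amalgamation K) (hB : B ∈ K) (hD : D ∈ K)
    {P : Set ((B ↪[L] D) × (B ↪[L] D))} (hP : P.Finite) :
    ∃ E ∈ K, ∃ i : D ↪[L] E, ∀ p ∈ P, ∃ f : D ↪[L] E, f.comp p.1 = i.comp p.2 := by
  induction P, hP using Set.Finite.induction_on with
  | empty => exact ⟨D, hD, Embedding.refl L D, by simp⟩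
  | @insert p P _ _ ih =>
    obtain ⟨E, hE, i, hi⟩ := ih
    obtain ⟨Q, f, g, hQ, hfg⟩ := hK B D E p.1 (i.comp p.2) hB hD hE
    refine ⟨Q, hQ, g.comp i, ?_⟩
    rintro r (rfl | hr)
    · exact ⟨f, hfg⟩
    · obtain ⟨f', hf'⟩ := hi r hr
      exact ⟨g.comp f', by rw [Embedding.comp_assoc, hf', Embedding.comp_assoc]⟩

namespace IsRamsey

theorem exists_homogeneous_order (hR : IsRamsey K) (hfin : ∀ A ∈ K, Finite A) (hD : D ∈ K)
    (hE : E ∈ K) :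
    ∃ g : E → ℕ, Function.Injective g ∧ ∀ f f' : D ↪[L] E, ∃ t : D ≃[L] D, ∀ x y,
      g (f x) ≤ g (f y) ↔ g (f' (t x)) ≤ g (f' (t y)) := by
  have := hfin D hD
  obtain ⟨C, hC, h⟩ := hR.exists_colour_eq_colour_comp_equiv hD hE (D → D → Prop)
  have := hfin C hC
  obtain ⟨o, ho⟩ := exists_injective_nat C
  obtain ⟨b, hb⟩ := h fun e x y => o (e x) ≤ o (e y)
  refine ⟨o ∘ b, ho.comp b.injective, fun f f' => ?_⟩
  obtain ⟨t, ht⟩ := hb f f'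
  exact ⟨t, fun x y => iff_of_eq (congrFun₂ ht x y)⟩

theorem exists_order_monovaryOn_range_iff (hR : IsRamsey K) (hfin : ∀ A ∈ K, Finite A)
    (hamalg : Amalgamation K) {N : ℕ} (hN : ∀ D ∈ K, Nat.card (D ≃[L] D) ≤ N) (hA : A ∈ K)
    (hB : B ∈ K) (s : B ↪[L] B) :
    ∃ w : B → ℕ, Function.Injective w ∧ ∀ e e' : A ↪[L] B,
      MonovaryOn (w ∘ s) w (Set.range e) ↔ MonovaryOn (w ∘ s) w (Set.range e') := by
  have := hfin B hB
  obtain ⟨D, hD, hmono⟩ := hR.exists_monochromatic hA hB (Set (Fin N))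
  have := hfin D hD
  obtain ⟨E, hE, i, hi⟩ := exists_extension_of_amalgamation hamalg hB hD
    (Set.finite_range fun j : B ↪[L] D => (j, j.comp s))
  obtain ⟨g, hg, hom⟩ := hR.exists_homogeneous_order hfin hD hE
  obtain ⟨ν, ν_injective⟩ := exists_injective_fin_of_card_le (hN D hD)
  obtain ⟨j, hj⟩ := hmono fun R => ν '' {t | MonovaryOn (g ∘ i ∘ t) (g ∘ i) R}
  obtain ⟨f, hf⟩ := hi _ ⟨j, rfl⟩
  obtain ⟨t, ht⟩ := hom f i
  have f_apply (y : B) : f (j y) = i (j (s y)) := DFunLike.congr_fun hf y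
  have monovaryOn_iff (e : A ↪[L] B) :
      MonovaryOn (g ∘ i ∘ t) (g ∘ i) ((j.comp e).toHom.range : Set D) ↔
        MonovaryOn ((g ∘ i ∘ j) ∘ s) (g ∘ i ∘ j) (Set.range e) := by
    simp only [MonovaryOn, Hom.range_coe, Set.forall_mem_range, Embedding.coe_toHom,
      Embedding.comp_apply, Function.comp_apply, ← ht, f_apply]
  refine ⟨g ∘ i ∘ j, hg.comp (i.injective.comp j.injective), fun e e' => ?_⟩
  rw [← monovaryOn_iff, ← monovaryOn_iff]
  exact Set.ext_iff.1 (ν_injective.image_injective (hj e e')) t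

theorem eq_one_of_odd_of_pow_eq_one [L.IsRelational] (hR : IsRamsey K)
    (hfin : ∀ A ∈ K, Finite A) (hher : Hereditary K) (hamalg : Amalgamation K) {N : ℕ}
    (hN : ∀ D ∈ K, Nat.card (D ≃[L] D) ≤ N) (hB : B ∈ K) {s : B ≃[L] B} {q : ℕ} (hq : Odd q)
    (hs : s ^ q = 1) : s = 1 := by
  ext x
  let S : L.Substructure B := Substructure.closure L {x, s x}
  have coe_S : (S : Set B) = {x, s x} := Substructure.closure_eq_of_isRelational L _
  let A : Bundled.{w} L.Structure := Bundled.of S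
  have hA : A ∈ K := by
    have := hfin B hB
    exact hher B hB ⟨(Structure.FG.of_finite : Structure.FG L S), ⟨S.subtype⟩⟩
  obtain ⟨w, hw, hmono⟩ :=
    hR.exists_order_monovaryOn_range_iff hfin hamalg hN hA hB s.toEmbedding
  let e (k : ℕ) : A ↪[L] B := (s ^ k).toEmbedding.comp S.subtype
  have range_e (k : ℕ) : Set.range (e k) = {s^[k] x, s^[k + 1] x} :=
    calc Set.range (e k) = s^[k] '' S := by
          rw [← coe_automorphism_pow, ← Subtype.range_coe (s := (S : Set B)), ← Set.range_comp]
          rfl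
      _ = {s^[k] x, s^[k + 1] x} := by rw [coe_S, Set.image_pair, Function.iterate_succ_apply]
  refine isFixedPt_of_odd_of_monovaryOn_iff hw s.injective hq ?_ fun k => ?_
  · rw [Function.IsPeriodicPt, ← coe_automorphism_pow, hs]
    rfl
  · have := hmono (e k) (e 0)
    rw [range_e, range_e] at this
    exact this

end IsRamsey

end OddOrder

end FraisseRamsey

open FraisseRamsey in
theorem theorem3p8_general {L : FirstOrder.Language.{u, v}} [L.IsRelational]
    {K : Set (CategoryTheory.Bundled.{w} L.Structure)} (hfin : ∀ A ∈ K, Finite A)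
    (hher : FirstOrder.Language.Hereditary K) (hamalg : FirstOrder.Language.Amalgamation K)
    (hR : IsRamsey K) : embRamseyDegree K = ⊤ ∨ ∃ m : ℕ, embRamseyDegree K = 2 ^ m := by
  refine or_iff_not_imp_left.2 fun htop => ?_
  have degree_eq (B) (hB : B ∈ K) : embRamseyDegreeOf K B = Nat.card (B ≃[L] B) :=
    have := hfin B hB
    hR.embRamseyDegreeOf_eq_card_automorphisms hB
  obtain ⟨A, hA, hmax⟩ := exists_embRamseyDegreeOf_eq_embRamseyDegree hR.nonempty htop
  rw [degree_eq A hA] at hmax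
  have card_le (B) (hB : B ∈ K) : Nat.card (B ≃[L] B) ≤ Nat.card (A ≃[L] A) := by
    have := embRamseyDegreeOf_le_embRamseyDegree hB
    rw [degree_eq B hB, ← hmax] at this
    exact_mod_cast this
  have := hfin A hA
  have hA2 : IsPGroup 2 (A ≃[L] A) := isPGroup_two_of_odd_pow_eq_one fun s q hq hs =>
    hR.eq_one_of_odd_of_pow_eq_one hfin hher hamalg card_le hA hq hs
  obtain ⟨m, hm⟩ := hA2.exists_card_eq
  exact ⟨m, by rw [← hmax, hm, Nat.cast_pow, Nat.cast_ofNat]⟩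

theorem theorem3p8 {L : FirstOrder.Language.{u, v}} [L.IsRelational] [Countable L.Symbols]
    (K : Set (CategoryTheory.Bundled.{w} L.Structure))
    (hK : FraisseRamsey.IsFraisseClass K) (hR : FraisseRamsey.IsRamsey K) :
    FraisseRamsey.embRamseyDegree K = ⊤ ∨
      ∃ m : ℕ, FraisseRamsey.embRamseyDegree K = 2 ^ m :=
  theorem3p8_general hK.finite hK.hereditary hK.amalgamation hR
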